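/- Let $\mu>0$ and $\lambda>0$, let $(N_t)_{t\ge 0}$ be a Poisson process of rate $\lambda$, let $W_1,W_2,\dots$ be i.i.d. random variables with law $F$ on $(0,\infty)$, independent of $(N_t)$, and put $Z_t=\sum_{i=1}^{N_t}W_i$. Let $X$ be the compound-Poisson-driven Ornstein–Uhlenbeck process on $[0,\infty)$, i.e. the Markov process solving $$dX_t=-\mu X_t\,dt+dZ_t,\qquad X_0=x\ge 0,$$ with transition probabilities $P^t(x,\cdot)$. Let $G$ be the law of $\log W_1$. (i) If $\int_{\mathbb R} \max(x,0)\,G(dx)=\infty$ (in particular, if $\int x\,G(dx)=\infty$), then $X$ is not positive recurrent: it is not the case that $X$ is $\phi$-irreducible for some nonzero $\sigma$-finite measure $\phi$ and has an invariant probability measure. In particular, $X$ is not positive Harris-recurrent, that is, it is not a Harris-recurrent process with an invariant probability measure. (ii) If $G$ is heavy-tailed, i.e. $\int_{\mathbb R} e^{\kappa x}\,G(dx)=\infty$ for every $\kappa>0$, then $X$ is not geometrically ergodic: there are no invariant probability measure $\pi$ and constant $\kappa>1$ such that $\lim_{t\to\infty}\kappa^t\,\|P^t(x,\cdot)-\pi\|_{\mathrm{TV}}=0$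 for all $x\ge 0$. Here $X$ is $\phi$-irreducible if $\phi(A)>0$ implies $\mathbb E_x\int_0^\infty \mathbf 1_A(X_s)\,ds>0$ for all $x$; $X$ is Harris-recurrent if for some nonzero $\sigma$-finite $\phi$, $\phi(A)>0$ implies $\mathbb P_x\bigl(\int_0^\infty \mathbf 1_A(X_s)\,ds=\infty\bigr)=1$ for all $x$ ($A$ Borel); and $\|\nu\|_{\mathrm{TV}}=\sup_A\nu(A)-\inf_A\nu(A)$. -/

import Mathlib

open MeasureTheory ProbabilityTheory Filter Topology
open scoped NNReal ENNReal

noncomputable section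

/-! ### Markov families: a family `X x t` of random variables, `x` the initial state, `t` time -/

section MarkovFamily

variable {Ω E : Type*} [MeasurableSpace Ω] [MeasurableSpace E]

/-- The transition probability `P^t(x, ·)`: the law of `X_t` when the process starts at `x`. -/
def transLaw (P : Measure Ω) (X : E → ℝ≥0 → Ω → E) (t : ℝ≥0) (x : E) : Measure E :=
  P.map (X x t)

/-- `π` is an invariant measure: `π P^t = π` for all `t ≥ 0`. -/
def IsInvariantMeasure (P : Measure Ω) (X : E → ℝ≥0 → Ω → E) (π : Measure E) : Prop :=
  ∀ t : ℝ≥0, ∀ A : Set E, MeasurableSet A → ∫⁻ x, transLaw P X t x A ∂π = π A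

/-- The occupation time `∫_0^∞ 1_A(X_s) ds` of the set `A` by a path. -/
def occupationTime (path : ℝ≥0 → E) (A : Set E) : ℝ≥0∞ :=
  ∫⁻ s in Set.Ici (0 : ℝ), A.indicator (fun _ => (1 : ℝ≥0∞)) (path s.toNNReal)

/-- The process is `φ`-irreducible: sets of positive `φ`-measure have, from every starting point,
a positive expected occupation time. -/
def IsPhiIrreducible (P : Measure Ω) (X : E → ℝ≥0 → Ω → E) (φ : Measure E) : Prop :=
  ∀ A : Set E, MeasurableSet A → 0 < φ A →
    ∀ x : E, 0 < ∫⁻ ω, occupationTime (fun s => X x s ω) A ∂P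

/-- The process is positive recurrent: it is `φ`-irreducible for some nontrivial `σ`-finite
measure `φ`, and it has an invariant probability measure. -/
def IsPositiveRecurrent (P : Measure Ω) (X : E → ℝ≥0 → Ω → E) : Prop :=
  (∃ φ : Measure E, SigmaFinite φ ∧ φ ≠ 0 ∧ IsPhiIrreducible P X φ) ∧
    ∃ π : Measure E, IsProbabilityMeasure π ∧ IsInvariantMeasure P X π

/-- The process is Harris-recurrent: for some nontrivial `σ`-finite measure `φ`, sets of positive
`φ`-measure have, from every starting point, almost surely an infinite occupation time. -/
def IsHarrisRecurrent (P : Measure Ω) (X : E → ℝ≥0 → Ω → E) : Prop :=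
  ∃ φ : Measure E, SigmaFinite φ ∧ φ ≠ 0 ∧
    ∀ A : Set E, MeasurableSet A → 0 < φ A →
      ∀ x : E, ∀ᵐ ω ∂P, occupationTime (fun s => X x s ω) A = ⊤

/-- The process is positive Harris-recurrent: it is Harris-recurrent and has a finite nonzero
(equivalently, after normalization, a probability) invariant measure. -/
def IsPositiveHarrisRecurrent (P : Measure Ω) (X : E → ℝ≥0 → Ω → E) : Prop :=
  IsHarrisRecurrent P X ∧ ∃ π : Measure E, IsProbabilityMeasure π ∧ IsInvariantMeasure P X π

/-- The total variation norm `‖ν₁ - ν₂‖ = sup_A (ν₁ - ν₂)(A) - inf_A (ν₁ - ν₂)(A)` of the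
difference of two finite measures, `A` running over the measurable sets. -/
def tvNormSub (ν₁ ν₂ : Measure E) : ℝ :=
  (⨆ A : {A : Set E // MeasurableSet A}, (ν₁.real A.1 - ν₂.real A.1)) -
    ⨅ A : {A : Set E // MeasurableSet A}, (ν₁.real A.1 - ν₂.real A.1)

/-- The process is geometrically ergodic: it has an invariant probability measure `π`, and for
some `κ > 1`, `κ ^ t * ‖P^t(x, ·) - π‖ → 0` as `t → ∞`, for every `x`. -/
def IsGeometricallyErgodic (P : Measure Ω) (X : E → ℝ≥0 → Ω → E) : Prop :=
  ∃ π : Measure E, IsProbabilityMeasure π ∧ IsInvariantMeasure P X π ∧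
    ∃ κ : ℝ, 1 < κ ∧ ∀ x : E,
      Tendsto (fun t : ℝ≥0 => κ ^ (t : ℝ) * tvNormSub (transLaw P X t x) π) atTop (𝓝 0)

end MarkovFamily

/-! ### The compound-Poisson-driven Ornstein-Uhlenbeck process -/

section OrnsteinUhlenbeck

variable {Ω : Type*} [MeasurableSpace Ω]

/-- `N` is a Poisson process of rate `lam`: almost surely it starts at `0` and has nondecreasing
right-continuous paths, its increments over disjoint intervals are independent, and
`N_t - N_s` has the Poisson distribution with parameter `lam * (t - s)` for `s ≤ t`. -/
structure IsPoissonProcess (lam : ℝ≥0) (N : ℝ≥0 → Ω → ℕ) (P : Measure Ω) : Prop where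
  measurable : ∀ t, Measurable (N t)
  zero : ∀ᵐ ω ∂P, N 0 ω = 0
  mono : ∀ᵐ ω ∂P, Monotone fun t => N t ω
  rightCts : ∀ᵐ ω ∂P, ∀ t, ContinuousWithinAt (fun s => N s ω) (Set.Ici t) t
  indep : HasIndepIncrements N P
  law : ∀ s t : ℝ≥0, s ≤ t → HasLaw (fun ω => N t ω - N s ω) (poissonMeasure (lam * (t - s))) P

/-- `N` and `W` are the ingredients of a compound Poisson process with rate `lam` and jump law `F`:
`N` is a Poisson process of rate `lam`, the `W i` are i.i.d. with law `F`, and the process `N` is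
independent of the sequence `W`. -/
structure IsCompoundPoissonData (lam : ℝ≥0) (F : Measure ℝ) (N : ℝ≥0 → Ω → ℕ) (W : ℕ → Ω → ℝ)
    (P : Measure Ω) : Prop where
  poisson : IsPoissonProcess lam N P
  jump_measurable : ∀ i, Measurable (W i)
  jump_law : ∀ i, P.map (W i) = F
  jump_indep : iIndepFun W P
  indep : IndepFun (fun ω t => N t ω) (fun ω i => W i ω) P

/-- The compound Poisson process `Z_t`, the sum of the first `N_t` jumps. -/
def compoundPoisson (N : ℝ≥0 → Ω → ℕ) (W : ℕ → Ω → ℝ) (t : ℝ≥0) (ω : Ω) : ℝ :=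
  ∑ i ∈ Finset.range (N t ω), W i ω

/-- `X x` is, for every initial state `x ≥ 0`, a `[0, ∞)`-valued solution of the equation
`dX_t = -μ X_t dt + dZ_t`, `X_0 = x`: almost surely, the path is locally integrable and
`X_t = x - μ ∫_0^t X_s ds + Z_t` for all `t ≥ 0`. -/
structure IsOUProcess (μ : ℝ) (Z : ℝ≥0 → Ω → ℝ) (X : ℝ≥0 → ℝ≥0 → Ω → ℝ≥0) (P : Measure Ω) :
    Prop where
  measurable : ∀ x t, Measurable (X x t)
  integrable : ∀ x, ∀ᵐ ω ∂P, ∀ t : ℝ≥0,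
    IntervalIntegrable (fun s : ℝ => (X x s.toNNReal ω : ℝ)) volume 0 t
  eq : ∀ x, ∀ᵐ ω ∂P, ∀ t : ℝ≥0,
    (X x t ω : ℝ) = x - μ * (∫ s in (0 : ℝ)..t, (X x s.toNNReal ω : ℝ)) + Z t ω

/-- The law `G(A) = F(e^A)` of the log jump sizes, for a law `F` of positive jumps. -/
def logJumpLaw (F : Measure ℝ) : Measure ℝ := F.map Real.log

/-- A law `G` on the real line is heavy-tailed if `∫ e^{κ x} G(dx) = ∞` for all `κ > 0`. -/
def IsHeavyTailed (G : Measure ℝ) : Prop :=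
  ∀ κ : ℝ, 0 < κ → ∫⁻ x, ENNReal.ofReal (Real.exp (κ * x)) ∂G = ⊤

end OrnsteinUhlenbeck

end

/-! Each part bounds the tail of `logJumpLaw F` through an invariant probability `π`.

(i) Fix `h > 0` with `μ h ≤ 1/2`. Over this time the drift removes at most half of the total input,
so `X_h ≥ (x + Z_h) / 2`. Hence `π [0, K] ≤ P(Z_h ≤ 2K) π [0, 2K]` (`invariant_Iic_le`). Iterating
along `K = 2 ^ m` gives a product with factors at most `1 - p F(2 ^ j, ∞)`, where `p = P(N_h ≥ 1)`.
Were these tails not summable, `π` would vanish; their summability is integrability of the positive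
part of the log jump.

(ii) Paths driven by the same noise differ by `e^{-μ t} x`, so starting above `y = K e^{μ t}` forces
`X_t > K`, whereas from `0` the process is mostly below `K`. Convergence at rate `κ ^ (-t)` thus
forces `π (y, ∞) ≤ 2 κ ^ (-t)`, a power tail of exponent `log κ / μ` (`transLaw_add_le_invariant`).
A single jump within time `h` passes this tail on to `F`, giving the log jump an exponential moment.
-/

/-- A solution of the integral equation `f = x - μ ∫ f` on `[0, ∞)` is `x e^{-μ t}`. -/
theorem eq_exp_mul_of_eq_sub_integral {μ x : ℝ} {f : ℝ → ℝ}
    (hint : ∀ t : ℝ, 0 ≤ t → IntervalIntegrable f volume 0 t)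
    (heq : ∀ t : ℝ, 0 ≤ t → f t = x - μ * ∫ s in (0 : ℝ)..t, f s) {t : ℝ} (ht : 0 ≤ t) :
    f t = Real.exp (-μ * t) * x := by
  -- Bootstrap: integrability makes the primitive continuous, hence `f` too, hence the primitive is
  -- differentiable.
  have hcont : ContinuousOn f (Set.Ici 0) := by
    intro s hs
    have hs' : (0 : ℝ) ≤ s := hs
    have h1 : IntegrableOn f (Set.uIcc 0 (s + 1)) := by
      rw [Set.uIcc_of_le (by linarith), integrableOn_Icc_iff_integrableOn_Ioc,
        ← intervalIntegrable_iff_integrableOn_Ioc_of_le (by linarith)]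
      exact hint _ (by linarith)
    have h2 : ContinuousOn (fun u => x - μ * ∫ v in (0 : ℝ)..u, f v) (Set.Icc 0 (s + 1)) := by
      have := intervalIntegral.continuousOn_primitive_interval h1
      rw [Set.uIcc_of_le (by linarith)] at this
      fun_prop
    have h3 : ContinuousOn f (Set.Icc 0 (s + 1)) := h2.congr fun u hu => heq u hu.1
    refine (h3 s ⟨hs', by linarith⟩).mono_of_mem_nhdsWithin ?_
    have : Set.Iio (s + 1) ∈ 𝓝 s := Iio_mem_nhds (by linarith)
    filter_upwards [self_mem_nhdsWithin, mem_nhdsWithin_of_mem_nhds this] with u hu hu'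
    exact ⟨hu, le_of_lt hu'⟩
  have hderiv : ∀ s : ℝ, 0 ≤ s → HasDerivWithinAt f (-μ * f s) (Set.Ici s) s := by
    intro s hs
    have hsub : Set.Ioi s ⊆ Set.Ici 0 := fun u hu => hs.trans (le_of_lt hu)
    have h1 : HasDerivWithinAt (fun u => ∫ v in (0 : ℝ)..u, f v) (f s) (Set.Ici s) s := by
      refine intervalIntegral.integral_hasDerivWithinAt_right (hint s hs) (t := Set.Ioi s) ?_
        ((hcont s hs).mono hsub)
      exact (hcont.mono hsub).stronglyMeasurableAtFilter_nhdsWithin measurableSet_Ioi s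
    have h2 := (h1.const_mul μ).const_sub x
    rw [neg_mul]
    exact h2.congr (fun u hu => heq u (hs.trans hu)) (heq s hs)
  -- Integrating factor: `e^{μ s} f s` has zero right derivative.
  have hconst := constant_of_has_deriv_right_zero (f := fun s => Real.exp (μ * s) * f s)
    (a := 0) (b := t)
    ((by fun_prop : Continuous fun s => Real.exp (μ * s)).continuousOn.mul
      (hcont.mono fun u hu => hu.1)) ?_ t ⟨ht, le_rfl⟩
  · have h0 : f 0 = x := by simpa using heq 0 le_rfl
    simp only [mul_zero, Real.exp_zero, one_mul, h0] at hconst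
    rw [← hconst, ← mul_assoc, ← Real.exp_add]
    simp
  · intro s hs
    have h1 : HasDerivAt (fun s => Real.exp (μ * s)) (Real.exp (μ * s) * μ) s := by
      simpa using ((hasDerivAt_id s).const_mul μ).exp
    exact (h1.hasDerivWithinAt.mul (hderiv s hs.1)).congr_deriv (by ring)

/-! ### Pathwise comparison and inequalities for an invariant law. -/

section OUProcess

variable {Ω : Type*} [MeasurableSpace Ω] {P : Measure Ω} {μ : ℝ} {lam : ℝ≥0} {F : Measure ℝ}
  {N : ℝ≥0 → Ω → ℕ} {W : ℕ → Ω → ℝ} {Z : ℝ≥0 → Ω → ℝ} {X : ℝ≥0 → ℝ≥0 → Ω → ℝ≥0}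

/-- The noise cancels in the difference of the two paths, leaving the homogeneous equation. -/
theorem IsOUProcess.ae_eq_add_exp (hX : IsOUProcess μ Z X P) (x t : ℝ≥0) :
    ∀ᵐ ω ∂P, (X x t ω : ℝ) = X 0 t ω + Real.exp (-μ * t) * x := by
  filter_upwards [hX.integrable x, hX.integrable 0, hX.eq x, hX.eq 0] with ω h1 h2 h3 h4
  have key := eq_exp_mul_of_eq_sub_integral (μ := μ) (x := x)
    (f := fun s : ℝ => (X x s.toNNReal ω : ℝ) - X 0 s.toNNReal ω) ?_ ?_ t.2
  · simp only [NNReal.val_eq_coe, Real.toNNReal_coe] at key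
    linarith
  · intro s hs
    lift s to ℝ≥0 using hs
    exact (h1 s).sub (h2 s)
  · intro s hs
    lift s to ℝ≥0 using hs
    rw [intervalIntegral.integral_sub (h1 s) (h2 s)]
    simp only [Real.toNNReal_coe]
    rw [h3 s, h4 s]
    push_cast
    ring

theorem IsOUProcess.ae_half_le (hX : IsOUProcess μ Z X P) (hμ : 0 < μ)
    (hmono : ∀ᵐ ω ∂P, Monotone fun t => Z t ω)
    {h : ℝ≥0} (hh : μ * h ≤ 1 / 2) (hnonneg : ∀ᵐ ω ∂P, 0 ≤ Z h ω) (x : ℝ≥0) :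
    ∀ᵐ ω ∂P, (x + Z h ω) / 2 ≤ X x h ω := by
  filter_upwards [hX.integrable x, hX.eq x, hmono, hnonneg] with ω h1 h2 hm h0
  -- The drift only lowers the path, and `Z` is nondecreasing.
  have hle : ∀ s ∈ Set.Icc (0 : ℝ) h, (X x s.toNNReal ω : ℝ) ≤ x + Z h ω := by
    intro s hs
    lift s to ℝ≥0 using hs.1
    have hint : 0 ≤ ∫ u in (0 : ℝ)..s, (X x u.toNNReal ω : ℝ) :=
      intervalIntegral.integral_nonneg s.2 fun u _ => NNReal.coe_nonneg _
    have hZ : Z s ω ≤ Z h ω := hm (by exact_mod_cast hs.2)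
    have := mul_nonneg hμ.le hint
    rw [Real.toNNReal_coe, h2 s]
    linarith
  have hint := intervalIntegral.integral_mono_on h.2 (h1 h)
    (intervalIntegrable_const (c := (x + Z h ω : ℝ))) hle
  simp only [NNReal.val_eq_coe, intervalIntegral.integral_const, sub_zero, smul_eq_mul] at hint
  have hb := mul_le_mul_of_nonneg_left hint hμ.le
  have hc : μ * h * (x + Z h ω) ≤ 1 / 2 * (x + Z h ω) :=
    mul_le_mul_of_nonneg_right hh (by positivity)
  rw [h2 h]
  linarith

theorem IsCompoundPoissonData.ae_jump_pos (hNW : IsCompoundPoissonData lam F N W P)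
    (hF : F (Set.Iic 0) = 0) : ∀ᵐ ω ∂P, ∀ i, 0 < W i ω := by
  rw [ae_all_iff]
  intro i
  have := hF
  rw [← hNW.jump_law i, Measure.map_apply (hNW.jump_measurable i) measurableSet_Iic] at this
  filter_upwards [measure_eq_zero_iff_ae_notMem.1 this] with ω hω
  simpa using hω

theorem IsCompoundPoissonData.ae_monotone (hNW : IsCompoundPoissonData lam F N W P)
    (hF : F (Set.Iic 0) = 0) : ∀ᵐ ω ∂P, Monotone fun t => compoundPoisson N W t ω := by
  filter_upwards [hNW.ae_jump_pos hF, hNW.poisson.mono] with ω hW hN s t hst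
  exact Finset.sum_le_sum_of_subset_of_nonneg (Finset.range_mono (hN hst))
    fun i _ _ => (hW i).le

theorem IsCompoundPoissonData.ae_nonneg (hNW : IsCompoundPoissonData lam F N W P)
    (hF : F (Set.Iic 0) = 0) (t : ℝ≥0) : ∀ᵐ ω ∂P, 0 ≤ compoundPoisson N W t ω := by
  filter_upwards [hNW.ae_jump_pos hF] with ω hW
  exact Finset.sum_nonneg fun i _ => (hW i).le

theorem IsPoissonProcess.measure_jump_pos (hN : IsPoissonProcess lam N P) (hlam : 0 < lam)
    {h : ℝ≥0} (hh : 0 < h) : 0 < P {ω | 1 ≤ N h ω} := by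
  have hlaw := hN.law 0 h zero_le
  have hr : 0 < lam * (h - 0) := by rw [tsub_zero]; positivity
  have h1 : 0 < poissonMeasure (lam * (h - 0)) {1} := by
    rw [poissonMeasure_singleton, ENNReal.ofReal_pos]
    positivity
  rw [← hlaw.map_eq, Measure.map_apply_of_aemeasurable hlaw.aemeasurable
    (measurableSet_singleton _)] at h1
  refine h1.trans_le (measure_mono fun ω hω => ?_)
  simp only [Set.mem_preimage, Set.mem_singleton_iff, Set.mem_ofPred_eq] at hω ⊢
  omega

/-- With positive jumps, one jump by time `h` whose first size exceeds `y` already suffices. -/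
theorem IsCompoundPoissonData.mul_tail_le (hNW : IsCompoundPoissonData lam F N W P)
    (hF : F (Set.Iic 0) = 0) (h : ℝ≥0) (y : ℝ) :
    P {ω | 1 ≤ N h ω} * F (Set.Ioi y) ≤ P {ω | y < compoundPoisson N W h ω} := by
  have hind : IndepFun (N h) (W 0) P :=
    hNW.indep.comp (φ := fun p : ℝ≥0 → ℕ => p h) (ψ := fun p : ℕ → ℝ => p 0) (measurable_pi_apply h)
      (measurable_pi_apply 0)
  have hprod := hind.measure_inter_preimage_eq_mul (Set.Ici 1) (Set.Ioi y) (measurableSet_Ici)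
    measurableSet_Ioi
  rw [← hNW.jump_law 0, Measure.map_apply (hNW.jump_measurable 0) measurableSet_Ioi]
  refine hprod.symm.trans_le (measure_mono_ae ?_)
  filter_upwards [hNW.ae_jump_pos hF] with ω hW hω
  refine lt_of_lt_of_le hω.2 ?_
  exact Finset.single_le_sum (f := fun i => W i ω) (fun i _ => (hW i).le)
    (Finset.mem_range.2 (Nat.lt_of_lt_of_le Nat.zero_lt_one hω.1))

theorem IsCompoundPoissonData.measurable_compoundPoisson
    (hNW : IsCompoundPoissonData lam F N W P) (t : ℝ≥0) : Measurable (compoundPoisson N W t) := by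
  have h : Measurable fun p : ℕ × Ω => ∑ i ∈ Finset.range p.1, W i p.2 :=
    measurable_from_prod_countable_right fun n =>
      Finset.measurable_sum (Finset.range n) fun i _ => hNW.jump_measurable i
  exact h.comp ((hNW.poisson.measurable t).prodMk measurable_id)

theorem IsOUProcess.invariant_Iic_le (hX : IsOUProcess μ Z X P) {h : ℝ≥0}
    (hhalf : ∀ x : ℝ≥0, ∀ᵐ ω ∂P, (x + Z h ω) / 2 ≤ X x h ω) (hnonneg : ∀ᵐ ω ∂P, 0 ≤ Z h ω)
    {π : Measure ℝ≥0} (hπ : IsInvariantMeasure P X π) (K : ℝ≥0) :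
    π (Set.Iic K) ≤ P {ω | Z h ω ≤ 2 * K} * π (Set.Iic (2 * K)) := by
  rw [← hπ h _ measurableSet_Iic, ← lintegral_indicator_const measurableSet_Iic]
  refine lintegral_mono fun x => ?_
  simp only [transLaw]
  rw [Measure.map_apply (hX.measurable x h) measurableSet_Iic]
  by_cases hx : x ≤ 2 * K
  · rw [Set.indicator_of_mem (Set.mem_Iic.2 hx)]
    refine measure_mono_ae ?_
    filter_upwards [hhalf x] with ω h1 h2
    have h3 : (X x h ω : ℝ) ≤ K := by exact_mod_cast h2
    have := x.2
    simp only [NNReal.val_eq_coe] at this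
    change Z h ω ≤ 2 * K
    linarith
  · rw [Set.indicator_of_notMem (by simpa using hx), nonpos_iff_eq_zero,
      measure_eq_zero_iff_ae_notMem]
    filter_upwards [hhalf x, hnonneg] with ω h1 h2 h3
    have h3 : (X x h ω : ℝ) ≤ K := by exact_mod_cast h3
    have h4 : (2 * K : ℝ) < x := by exact_mod_cast not_le.1 hx
    linarith

theorem IsOUProcess.tail_le_invariant_Ioi (hX : IsOUProcess μ Z X P) {h : ℝ≥0}
    (hhalf : ∀ x : ℝ≥0, ∀ᵐ ω ∂P, (x + Z h ω) / 2 ≤ X x h ω)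
    {π : Measure ℝ≥0} [IsProbabilityMeasure π] (hπ : IsInvariantMeasure P X π) (K : ℝ≥0) :
    P {ω | 2 * K < Z h ω} ≤ π (Set.Ioi K) := by
  rw [← hπ h _ measurableSet_Ioi]
  calc P {ω | 2 * K < Z h ω} = ∫⁻ _, P {ω | 2 * K < Z h ω} ∂π := by simp
    _ ≤ _ := lintegral_mono fun x => ?_
  simp only [transLaw]
  rw [Measure.map_apply (hX.measurable x h) measurableSet_Ioi]
  refine measure_mono_ae ?_
  filter_upwards [hhalf x] with ω h1 h2
  have h2 : 2 * K < Z h ω := h2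
  have hx := x.2
  simp only [NNReal.val_eq_coe] at hx
  have : (K : ℝ) < X x h ω := by linarith
  exact_mod_cast this

/-- From every start, `X_t > K` is at least as likely as from `0`; from a start above `y` it is
almost sure, which adds the missing mass `P^t(0, [0, K])`. -/
theorem IsOUProcess.transLaw_add_le_invariant [IsProbabilityMeasure P] (hX : IsOUProcess μ Z X P)
    {π : Measure ℝ≥0} [IsProbabilityMeasure π] (hπ : IsInvariantMeasure P X π) (t K y : ℝ≥0)
    (hy : (K : ℝ) ≤ Real.exp (-μ * t) * y) :
    transLaw P X t 0 (Set.Ioi K) + transLaw P X t 0 (Set.Iic K) * π (Set.Ioi y)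
      ≤ π (Set.Ioi K) := by
  rw [← hπ t (Set.Ioi K) measurableSet_Ioi, ← lintegral_indicator_const measurableSet_Ioi]
  calc _ = ∫⁻ x, (transLaw P X t 0 (Set.Ioi K) +
        (Set.Ioi y).indicator (fun _ => transLaw P X t 0 (Set.Iic K)) x) ∂π := by
        rw [lintegral_add_left measurable_const, lintegral_const, measure_univ, mul_one]
    _ ≤ _ := lintegral_mono fun x => ?_
  have hX' : ∀ᵐ ω ∂P, (X 0 t ω : ℝ) + Real.exp (-μ * t) * x ≤ X x t ω :=
    (hX.ae_eq_add_exp x t).mono fun ω hω => hω.ge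
  simp only [transLaw]
  by_cases hx : y < x
  · have : IsProbabilityMeasure (P.map (X 0 t)) :=
      Measure.isProbabilityMeasure_map (hX.measurable 0 t).aemeasurable
    rw [Set.indicator_of_mem (Set.mem_Ioi.2 hx), ← Set.compl_Ioi,
      measure_add_measure_compl measurableSet_Ioi, measure_univ,
      Measure.map_apply (hX.measurable x t) measurableSet_Ioi, ← measure_univ (μ := P)]
    refine measure_mono_ae ?_
    filter_upwards [hX'] with ω h1 _
    have hxy : Real.exp (-μ * t) * y < Real.exp (-μ * t) * x :=
      mul_lt_mul_of_pos_left (by exact_mod_cast hx) (Real.exp_pos _)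
    have := (X 0 t ω).2
    simp only [NNReal.val_eq_coe] at this
    have : (K : ℝ) < X x t ω := by linarith
    exact_mod_cast this
  · rw [Set.indicator_of_notMem (by simpa using hx), add_zero,
      Measure.map_apply (hX.measurable x t) measurableSet_Ioi,
      Measure.map_apply (hX.measurable 0 t) measurableSet_Ioi]
    refine measure_mono_ae ?_
    filter_upwards [hX'] with ω h1 h2
    have h2 : (K : ℝ) < X 0 t ω := by exact_mod_cast h2
    have : 0 ≤ Real.exp (-μ * t) * x := by positivity
    have : (K : ℝ) < X x t ω := by linarith
    exact_mod_cast this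

end OUProcess

/-! ### Moments from tails, and total variation. -/

theorem lintegral_ofReal_ne_top_of_summable_tail {G : Measure ℝ} [IsFiniteMeasure G] {c : ℝ}
    (hc : 0 < c) (hs : Summable fun j : ℕ => G.real (Set.Ioi (c * j))) :
    ∫⁻ x, ENNReal.ofReal x ∂G ≠ ⊤ := by
  -- For `x > 0` exactly `⌈x / c⌉₊` indices `j` satisfy `c * j < x`.
  have hpt : ∀ x : ℝ, ENNReal.ofReal x ≤
      ∑' j : ℕ, (Set.Ioi (c * j)).indicator (fun _ => ENNReal.ofReal c) x := by
    intro x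
    set n := ⌈x / c⌉₊
    calc ENNReal.ofReal x ≤ ENNReal.ofReal (n * c) := by
          apply ENNReal.ofReal_le_ofReal
          rw [← div_le_iff₀ hc]
          exact Nat.le_ceil _
      _ = ∑ j ∈ Finset.range n, (Set.Ioi (c * j)).indicator (fun _ => ENNReal.ofReal c) x := by
          rw [Finset.sum_congr rfl (g := fun _ => ENNReal.ofReal c)]
          · simp [ENNReal.ofReal_mul]
          · intro j hj
            have : (j : ℝ) < x / c := Nat.lt_ceil.1 (Finset.mem_range.1 hj)
            rw [lt_div_iff₀ hc] at this
            exact Set.indicator_of_mem (by rw [Set.mem_Ioi]; linarith) _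
      _ ≤ _ := ENNReal.sum_le_tsum _
  refine ne_top_of_le_ne_top ?_ (lintegral_mono hpt)
  rw [lintegral_tsum fun j => (measurable_const.indicator measurableSet_Ioi).aemeasurable]
  simp only [lintegral_indicator_const measurableSet_Ioi, ENNReal.tsum_mul_left]
  refine ENNReal.mul_ne_top ENNReal.ofReal_ne_top ?_
  exact ne_top_of_le_ne_top hs.tsum_ofReal_ne_top
    (ENNReal.tsum_le_tsum fun j => (ofReal_measureReal (measure_ne_top _ _)).ge)

theorem lintegral_exp_ne_top_of_tail_le {G : Measure ℝ} [IsFiniteMeasure G] {C α β : ℝ}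
    (hβ : 0 < β) (hβα : β < α)
    (htail : ∀ᶠ n : ℕ in atTop, G.real (Set.Ioi (n : ℝ)) ≤ C * Real.exp (-α * n)) :
    ∫⁻ x, ENNReal.ofReal (Real.exp (β * x)) ∂G ≠ ⊤ := by
  obtain ⟨M, hM⟩ := eventually_atTop.1 htail
  have hpt : ∀ x : ℝ, ENNReal.ofReal (Real.exp (β * x)) ≤ ENNReal.ofReal (Real.exp (β * M)) +
      ∑' j : ℕ, (Set.Ioi ((j + M : ℕ) : ℝ)).indicator
        (fun _ => ENNReal.ofReal (Real.exp (β * ((j + M : ℕ) + 1)))) x := by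
    intro x
    rcases le_or_gt x M with hx | hx
    · refine le_add_right (ENNReal.ofReal_le_ofReal (Real.exp_le_exp.2 ?_))
      exact mul_le_mul_of_nonneg_left hx hβ.le
    · refine le_add_left ?_
      obtain ⟨n, hn⟩ : ∃ n, ⌈x - M⌉₊ = n + 1 :=
        Nat.exists_eq_succ_of_ne_zero (Nat.ceil_pos.2 (by linarith)).ne'
      have h1 : (n : ℝ) < x - M := Nat.lt_ceil.1 (by omega)
      have h2 : x - M ≤ (n + 1 : ℕ) := hn ▸ Nat.le_ceil _
      refine le_trans ?_ (ENNReal.le_tsum n)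
      rw [Set.indicator_of_mem (by rw [Set.mem_Ioi]; push_cast; linarith)]
      refine ENNReal.ofReal_le_ofReal (Real.exp_le_exp.2 (mul_le_mul_of_nonneg_left ?_ hβ.le))
      push_cast at h2 ⊢
      linarith
  refine ne_top_of_le_ne_top ?_ (lintegral_mono hpt)
  rw [lintegral_add_left measurable_const,
    lintegral_tsum fun j => (measurable_const.indicator measurableSet_Ioi).aemeasurable]
  simp only [lintegral_const]
  refine ENNReal.add_ne_top.2 ⟨ENNReal.mul_ne_top ENNReal.ofReal_ne_top (measure_ne_top _ _), ?_⟩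
  simp only [lintegral_indicator_const measurableSet_Ioi]
  have hsum : Summable fun j : ℕ => Real.exp (β * ((j + M : ℕ) + 1)) *
      (C * Real.exp (-α * (j + M : ℕ))) := by
    have h1 : Summable fun j : ℕ => Real.exp (j * (β - α)) :=
      Real.summable_exp_nat_mul_iff.2 (by linarith)
    refine (h1.mul_left (C * Real.exp (β * (M + 1) - α * M))).congr fun j => ?_
    rw [mul_left_comm, ← Real.exp_add, mul_assoc, ← Real.exp_add]
    push_cast
    ring_nf
  refine ne_top_of_le_ne_top hsum.tsum_ofReal_ne_top (ENNReal.tsum_le_tsum fun j => ?_)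
  rw [ENNReal.ofReal_mul (Real.exp_pos _).le, ← ofReal_measureReal]
  gcongr
  exact hM _ (by omega)

theorem logJumpLaw_real_Ioi {F : Measure ℝ} (hF : F (Set.Iic 0) = 0) (r : ℝ) :
    (logJumpLaw F).real (Set.Ioi r) = F.real (Set.Ioi (Real.exp r)) := by
  rw [logJumpLaw, map_measureReal_apply Real.measurable_log measurableSet_Ioi]
  refine measureReal_congr ?_
  filter_upwards [measure_eq_zero_iff_ae_notMem.1 hF] with x hx
  have hx : 0 < x := by simpa using hx
  exact propext (Real.lt_log_iff_exp_lt hx)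

theorem le_tvNormSub {E : Type*} [MeasurableSpace E] (ν₁ ν₂ : Measure E) [IsProbabilityMeasure ν₁]
    [IsProbabilityMeasure ν₂] {A : Set E} (hA : MeasurableSet A) :
    ν₂.real A - ν₁.real A ≤ tvNormSub ν₁ ν₂ := by
  -- The empty set makes the supremum nonnegative, so the infimum alone gives the bound.
  have h1 : (0 : ℝ) ≤ ⨆ A : {A : Set E // MeasurableSet A}, (ν₁.real A.1 - ν₂.real A.1) := by
    refine le_ciSup_of_le ⟨1, ?_⟩ ⟨∅, MeasurableSet.empty⟩ (by simp)
    rintro _ ⟨B, rfl⟩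
    have h1 : ν₁.real B.1 ≤ 1 := measureReal_le_one
    have h2 : 0 ≤ ν₂.real B.1 := measureReal_nonneg
    change ν₁.real B.1 - ν₂.real B.1 ≤ 1
    linarith
  have h2 : ⨅ A : {A : Set E // MeasurableSet A}, (ν₁.real A.1 - ν₂.real A.1) ≤
      ν₁.real A - ν₂.real A := by
    refine ciInf_le (f := fun A : {A : Set E // MeasurableSet A} => ν₁.real A.1 - ν₂.real A.1)
      ⟨-1, ?_⟩ ⟨A, hA⟩
    rintro _ ⟨B, rfl⟩
    have h1 : ν₂.real B.1 ≤ 1 := measureReal_le_one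
    have h2 : 0 ≤ ν₁.real B.1 := measureReal_nonneg
    change -1 ≤ ν₁.real B.1 - ν₂.real B.1
    linarith
  unfold tvNormSub
  linarith

theorem tendsto_measureReal_Iic_two_pow (π : Measure ℝ≥0) [IsProbabilityMeasure π] :
    Tendsto (fun n : ℕ => π.real (Set.Iic (2 ^ n))) atTop (𝓝 1) := by
  have hU : ⋃ n : ℕ, Set.Iic ((2 : ℝ≥0) ^ n) = Set.univ := by
    refine Set.eq_univ_of_forall fun x => Set.mem_iUnion.2 ?_
    obtain ⟨n, hn⟩ := pow_unbounded_of_one_lt x (one_lt_two (α := ℝ≥0))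
    exact ⟨n, hn.le⟩
  have h := tendsto_measure_iUnion_atTop (μ := π) (s := fun n : ℕ => Set.Iic ((2 : ℝ≥0) ^ n))
    fun m n hmn => Set.Iic_subset_Iic.2 (pow_le_pow_right₀ one_le_two hmn)
  rw [hU, measure_univ] at h
  exact (ENNReal.tendsto_toReal ENNReal.one_ne_top).comp h

theorem exists_pos_mul_le_half {μ : ℝ} (hμ : 0 < μ) : ∃ h : ℝ≥0, 0 < h ∧ μ * h ≤ 1 / 2 := by
  refine ⟨(1 / (2 * μ)).toNNReal, Real.toNNReal_pos.2 (by positivity), ?_⟩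
  rw [Real.coe_toNNReal _ (by positivity)]
  exact le_of_eq (by field_simp)

/-! ### The two tail bounds for the log jump law. -/

section OUProcess

variable {Ω : Type*} [MeasurableSpace Ω] {P : Measure Ω} [IsProbabilityMeasure P] {μ : ℝ}
  {lam : ℝ≥0} {F : Measure ℝ} [IsProbabilityMeasure F] {N : ℝ≥0 → Ω → ℕ} {W : ℕ → Ω → ℝ}
  {X : ℝ≥0 → ℝ≥0 → Ω → ℝ≥0}

theorem lintegral_logJumpLaw_ne_top_of_invariant (hμ : 0 < μ) (hlam : 0 < lam)
    (hF : F (Set.Iic 0) = 0) (hNW : IsCompoundPoissonData lam F N W P)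
    (hX : IsOUProcess μ (compoundPoisson N W) X P) {π : Measure ℝ≥0} [IsProbabilityMeasure π]
    (hπ : IsInvariantMeasure P X π) : ∫⁻ x, ENNReal.ofReal x ∂(logJumpLaw F) ≠ ⊤ := by
  have : IsProbabilityMeasure (logJumpLaw F) :=
    Measure.isProbabilityMeasure_map Real.measurable_log.aemeasurable
  refine lintegral_ofReal_ne_top_of_summable_tail (Real.log_pos one_lt_two) ?_
  have hexp (j : ℕ) : Real.exp (Real.log 2 * j) = 2 ^ j := by
    rw [mul_comm, Real.exp_nat_mul, Real.exp_log two_pos]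
  simp only [logJumpLaw_real_Ioi hF, hexp]
  set b : ℕ → ℝ := fun j => F.real (Set.Ioi (2 ^ j))
  obtain ⟨h, hh0, hh⟩ := exists_pos_mul_le_half hμ
  have hhalf := hX.ae_half_le hμ (hNW.ae_monotone hF) hh (hNW.ae_nonneg hF h)
  set p : ℝ := P.real {ω | 1 ≤ N h ω}
  have hp : 0 < p :=
    ENNReal.toReal_pos (hNW.poisson.measure_jump_pos hlam hh0).ne' (measure_ne_top _ _)
  have hstep (m : ℕ) : π.real (Set.Iic (2 ^ m)) ≤
      Real.exp (-(p * b (m + 1))) * π.real (Set.Iic (2 ^ (m + 1))) := by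
    have h1 := ENNReal.toReal_mono (by finiteness)
      (hX.invariant_Iic_le hhalf (hNW.ae_nonneg hF h) hπ (2 ^ m))
    have h2 := ENNReal.toReal_mono (by finiteness) (hNW.mul_tail_le hF h (2 ^ (m + 1)))
    rw [ENNReal.toReal_mul] at h1 h2
    have h3 : P.real {ω | compoundPoisson N W h ω ≤ 2 ^ (m + 1)} =
        1 - P.real {ω | 2 ^ (m + 1) < compoundPoisson N W h ω} := by
      rw [← probReal_compl_eq_one_sub
        (measurableSet_lt measurable_const (hNW.measurable_compoundPoisson h))]
      congr 1
      ext ω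
      simp
    have h4 : P.real {ω | compoundPoisson N W h ω ≤ 2 ^ (m + 1)} ≤
        Real.exp (-(p * b (m + 1))) := by
      have h5 := Real.add_one_le_exp (-(p * b (m + 1)))
      have h6 : p * b (m + 1) ≤ P.real {ω | 2 ^ (m + 1) < compoundPoisson N W h ω} := h2
      linarith
    push_cast at h1
    rw [← pow_succ', ← pow_succ'] at h1
    exact h1.trans (mul_le_mul_of_nonneg_right h4 measureReal_nonneg)
  by_contra hns
  have hS := (not_summable_iff_tendsto_nat_atTop_of_nonneg fun _ => measureReal_nonneg).1 hns
  -- By `hstep` this normalization is nondecreasing; divergence of the sums sends it to `0`, so it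
  -- is nonpositive throughout.
  set u : ℕ → ℝ := fun m => π.real (Set.Iic (2 ^ m)) *
    Real.exp (-(p * ∑ j ∈ Finset.range (m + 1), b j))
  have hu : Monotone u := by
    refine monotone_nat_of_le_succ fun m => ?_
    refine (mul_le_mul_of_nonneg_right (hstep m) (Real.exp_pos _).le).trans_eq ?_
    change _ = _ * Real.exp (-(p * ∑ j ∈ Finset.range (m + 1 + 1), b j))
    rw [Finset.sum_range_succ _ (m + 1), mul_add, neg_add, Real.exp_add]
    ring
  have hu0 : Tendsto u atTop (𝓝 0) := by
    have he : Tendsto (fun m : ℕ => Real.exp (-(p * ∑ j ∈ Finset.range (m + 1), b j))) atTop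
        (𝓝 0) :=
      Real.tendsto_exp_neg_atTop_nhds_zero.comp
        ((hS.comp (tendsto_add_atTop_nat 1)).const_mul_atTop hp)
    refine squeeze_zero (fun m => by positivity) (fun m => ?_) he
    exact mul_le_of_le_one_left (Real.exp_pos _).le measureReal_le_one
  have hzero (m : ℕ) : π.real (Set.Iic (2 ^ m)) ≤ 0 :=
    nonpos_of_mul_nonpos_left (hu.ge_of_tendsto hu0 m) (Real.exp_pos _)
  exact absurd (le_of_tendsto' (tendsto_measureReal_Iic_two_pow π) hzero) (by norm_num)

theorem not_isHeavyTailed_of_isGeometricallyErgodic (hμ : 0 < μ) (hlam : 0 < lam)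
    (hF : F (Set.Iic 0) = 0) (hNW : IsCompoundPoissonData lam F N W P)
    (hX : IsOUProcess μ (compoundPoisson N W) X P) (hgeo : IsGeometricallyErgodic P X) :
    ¬ IsHeavyTailed (logJumpLaw F) := by
  obtain ⟨π, hπp, hπ, κ, hκ, hlim⟩ := hgeo
  have : IsProbabilityMeasure (logJumpLaw F) :=
    Measure.isProbabilityMeasure_map Real.measurable_log.aemeasurable
  have htr (t : ℝ≥0) : IsProbabilityMeasure (transLaw P X t 0) :=
    Measure.isProbabilityMeasure_map (hX.measurable 0 t).aemeasurable
  have hlogκ : 0 < Real.log κ := Real.log_pos hκ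
  obtain ⟨h, hh0, hh⟩ := exists_pos_mul_le_half hμ
  have hhalf := hX.ae_half_le hμ (hNW.ae_monotone hF) hh (hNW.ae_nonneg hF h)
  set p : ℝ := P.real {ω | 1 ≤ N h ω}
  have hp : 0 < p :=
    ENNReal.toReal_pos (hNW.poisson.measure_jump_pos hlam hh0).ne' (measure_ne_top _ _)
  obtain ⟨k, hk⟩ := ((tendsto_measureReal_Iic_two_pow π).eventually
    (lt_mem_nhds (by norm_num : (1 / 2 : ℝ) < 1))).exists
  set K : ℝ≥0 := 2 ^ k
  have hK0 : (0 : ℝ) < K := by positivity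
  have hKtail : π.real (Set.Ioi K) ≤ 1 / 2 := by
    rw [← Set.compl_Iic, probReal_compl_eq_one_sub measurableSet_Iic]
    linarith
  obtain ⟨T, hT⟩ := eventually_atTop.1 ((hlim 0).eventually (gt_mem_nhds zero_lt_one))
  have hinv (t : ℝ≥0) (ht : T ≤ t) (y : ℝ≥0) (hy : (K : ℝ) ≤ Real.exp (-μ * t) * y) :
      π.real (Set.Ioi y) ≤ 2 * Real.exp (-(Real.log κ * t)) := by
    have h1 := ENNReal.toReal_mono (by finiteness) (hX.transLaw_add_le_invariant hπ t K y hy)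
    rw [ENNReal.toReal_add (by finiteness) (by finiteness), ENNReal.toReal_mul] at h1
    change (transLaw P X t 0).real _ + (transLaw P X t 0).real _ * π.real _ ≤ π.real _ at h1
    rw [← Set.compl_Ioi, probReal_compl_eq_one_sub measurableSet_Ioi] at h1
    have h2 := le_tvNormSub (transLaw P X t 0) π (measurableSet_Ioi (a := K))
    have h3 : tvNormSub (transLaw P X t 0) π ≤ Real.exp (-(Real.log κ * t)) := by
      have := hT t ht
      rw [Real.rpow_def_of_pos (by linarith)] at this
      rw [Real.exp_neg, ← one_div, le_div_iff₀ (Real.exp_pos _)]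
      linarith
    set q := (transLaw P X t 0).real (Set.Ioi K)
    have hq : q ≤ 1 := measureReal_le_one
    have hy0 : 0 ≤ π.real (Set.Ioi y) := measureReal_nonneg
    have h4 : 0 ≤ (1 - q) * π.real (Set.Ioi y) := mul_nonneg (by linarith) hy0
    -- `h1` and `h4` give `q ≤ π.real (Set.Ioi K) ≤ 1/2`.
    have h5 : 1 / 2 * π.real (Set.Ioi y) ≤ (1 - q) * π.real (Set.Ioi y) :=
      mul_le_mul_of_nonneg_right (by linarith) hy0
    linarith
  set α := Real.log κ / μ
  have hα : 0 < α := by positivity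
  set L := Real.log (2 * K)
  have htail : ∀ᶠ n : ℕ in atTop, (logJumpLaw F).real (Set.Ioi (n : ℝ)) ≤
      2 / p * Real.exp (α * L) * Real.exp (-α * n) := by
    filter_upwards [tendsto_natCast_atTop_atTop.eventually_ge_atTop (μ * T + L)] with n hn
    have hTn : (T : ℝ) ≤ (n - L) / μ := by rw [le_div_iff₀ hμ]; linarith
    have ht0 : 0 ≤ (n - L) / μ := T.2.trans hTn
    -- `y` is chosen so that `2 * y = e^n`, and `t` so that `e^{-μ t} y = K`.
    set t : ℝ≥0 := ⟨(n - L) / μ, ht0⟩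
    have ht : (t : ℝ) = (n - L) / μ := rfl
    set y : ℝ≥0 := ⟨Real.exp n / 2, by positivity⟩
    have hy : (y : ℝ) = Real.exp n / 2 := rfl
    have hKy : (K : ℝ) ≤ Real.exp (-μ * t) * y := by
      rw [ht, hy, show -μ * ((n - L) / μ) = L - n by field_simp; ring, Real.exp_sub,
        Real.exp_log (by positivity)]
      field_simp
      rfl
    have h1 := hinv t hTn y hKy
    have h2 := ENNReal.toReal_mono (by finiteness) (hNW.mul_tail_le hF h (Real.exp n))
    have h3 := ENNReal.toReal_mono (by finiteness) (hX.tail_le_invariant_Ioi hhalf hπ y)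
    rw [ENNReal.toReal_mul] at h2
    rw [hy, mul_div_cancel₀ _ two_ne_zero] at h3
    rw [logJumpLaw_real_Ioi hF, mul_assoc, ← Real.exp_add, div_mul_eq_mul_div, le_div_iff₀' hp]
    refine (h2.trans h3).trans (h1.trans_eq ?_)
    rw [ht]
    congr 2
    simp only [α]
    field_simp
    ring
  intro hheavy
  exact lintegral_exp_ne_top_of_tail_le (half_pos hα) (half_lt_self hα) htail
    (hheavy _ (half_pos hα))

end OUProcess

theorem lemma17 {Ω : Type*} [MeasurableSpace Ω] (P : Measure Ω) [IsProbabilityMeasure P]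
    (μ : ℝ) (hμ : 0 < μ) (lam : ℝ≥0) (hlam : 0 < lam)
    (F : Measure ℝ) [IsProbabilityMeasure F] (hF : F (Set.Iic 0) = 0)
    (N : ℝ≥0 → Ω → ℕ) (W : ℕ → Ω → ℝ) (hNW : IsCompoundPoissonData lam F N W P)
    (X : ℝ≥0 → ℝ≥0 → Ω → ℝ≥0) (hX : IsOUProcess μ (compoundPoisson N W) X P) :
    (∫⁻ x, ENNReal.ofReal x ∂(logJumpLaw F) = ⊤ →
      ¬ IsPositiveRecurrent P X ∧ ¬ IsPositiveHarrisRecurrent P X) ∧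
    (IsHeavyTailed (logJumpLaw F) → ¬ IsGeometricallyErgodic P X) := by

  refine ⟨fun hG => ⟨?_, ?_⟩, fun hG hgeo => ?_⟩
  · rintro ⟨_, π, hπp, hπ⟩
    exact lintegral_logJumpLaw_ne_top_of_invariant hμ hlam hF hNW hX hπ hG
  · rintro ⟨_, π, hπp, hπ⟩
    exact lintegral_logJumpLaw_ne_top_of_invariant hμ hlam hF hNW hX hπ hG
  · exact not_isHeavyTailed_of_isGeometricallyErgodic hμ hlam hF hNW hX hgeo hG
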